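/- For $m\ge 2$ let $V_m=\{v_0<v_1<\dots<v_{m-1}\}$ be the chain of $m$ truth values with Gödel implication $x\Rightarrow y=v_{m-1}$ if $x\le y$ and $x\Rightarrow y=y$ if $x>y$. For $n\ge 1$ let $g_n^{(k)}$ be the number of pairs (bracketing, valuation), consisting of a full bracketing of $p_1\Rightarrow p_2\Rightarrow\dots\Rightarrow p_n$ ($n$ distinct variables) and a valuation $\{p_1,\dots,p_n\}\to V_m$, for which the bracketed formula takes the value $v_k$, and let $g_n=\sum_{k=0}^{m-1}g_n^{(k)}$. Then for each $m\ge2$ and $0\le k\le m-1$ the limit $p_k(m)=\lim_{n\to\infty}g_n^{(k)}/g_n$ exists, and $(p_k(m))_{0\le k\le m-1}$ is a probability distribution. For $m\ge2$ let $K_m$ be a random variable with $\Pr(K_m=k)=p_k(m)$ for $0\le k\le m-1$, and let $T_m=K_m/(m-1)$. Then for every $t\in[0,1)$ $$\Pr(T_m\ge t)=\sum_{j=\lceil t(m-1)\rceil}^{m-1}p_j(m)\longrightarrow\frac{1}{\sqrt{1+2t}}\qquad(m\to\infty),$$ $$\Pr(T_m=1)=p_{m-1}(m)\longrightarrow\frac1{\sqrt3}\qquad(m\to\infty),$$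 and $T_m$ converges in distribution, as $m\to\infty$, to a random variable $T$ whose law is the probability measure $$\mu(dx)=\frac{1}{(1+2x)^{3/2}}\,\mathbf 1_{[0,1)}(x)\,dx+\frac{1}{\sqrt3}\,\delta_1(dx).$$ Equivalently, the law of $T$ is the unique probability measure on $\mathbb R$ with $\Pr(T\ge t)=1/\sqrt{1+2t}$ for $0\le t<1$ and $\Pr(T=1)=1/\sqrt3$. -/

import Mathlib

open MeasureTheory Filter Topology Set

/-- Gödel implication on the chain `v_0 < v_1 < ⋯ < v_{m-1}`, where `v_k` is `k : Fin m`: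
the value is the top element `v_{m-1}` if `x ≤ y`, and `y` otherwise. -/
def godelImp {m : ℕ} (x y : Fin m) : Fin m :=
  if x ≤ y then ⟨m - 1, Nat.sub_lt x.pos Nat.one_pos⟩ else y

/-- Fully bracketed implication terms with variables in `α`. -/
inductive ImpTerm (α : Type) : Type
  | var : α → ImpTerm α
  | imp : ImpTerm α → ImpTerm α → ImpTerm α

namespace ImpTerm

/-- The variables of a term, read from left to right. -/
def word {α : Type} : ImpTerm α → List α
  | var a => [a]
  | imp φ ψ => φ.word ++ ψ.word

/-- The value of a term under a valuation of its variables in the Gödel `m`-chain. -/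
def eval {α : Type} {m : ℕ} (ν : α → Fin m) : ImpTerm α → Fin m
  | var a => ν a
  | imp φ ψ => godelImp (φ.eval ν) (ψ.eval ν)

end ImpTerm

/-- The set of all full bracketings of `p_1 ⇒ p_2 ⇒ ⋯ ⇒ p_n`; the variables are indexed by
`Fin n`. -/
def bracketings (n : ℕ) : Set (ImpTerm (Fin n)) :=
  {φ | φ.word = List.finRange n}

/-- The number of truth-table entries equal to `v_k`, over all bracketings on `n` variables and
all `m ^ n` valuations in the Gödel `m`-chain. -/
noncomputable def levelCount (m n : ℕ) (k : Fin m) : ℕ :=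
  Set.ncard {r : ImpTerm (Fin n) × (Fin n → Fin m) | r.1 ∈ bracketings n ∧ r.1.eval r.2 = k}

/-- The number of all truth-table entries. -/
noncomputable def totalCount (m n : ℕ) : ℕ := ∑ k : Fin m, levelCount m n k

/-- The proportion of truth-table entries equal to `v_k`. -/
noncomputable def levelProportion (m n : ℕ) (k : Fin m) : ℝ :=
  (levelCount m n k : ℝ) / (totalCount m n : ℝ)

/-- The limiting proportion `p_k(m)` of entries equal to `v_k`, as the number `n` of variables
tends to infinity. -/
noncomputable def limitProportion (m : ℕ) (k : Fin m) : ℝ :=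
  limUnder atTop (fun n : ℕ => levelProportion m n k)

/-- The measure on `ℝ` with density `(1 + 2x)^(-3/2)` on `[0, 1)` and an atom of mass `1/√3`
at `1`. -/
noncomputable def limitLaw : Measure ℝ :=
  (volume.restrict (Ico (0 : ℝ) 1)).withDensity
      (fun x => ENNReal.ofReal ((1 + 2 * x) ^ (-(3 / 2) : ℝ)))
    + ENNReal.ofReal (1 / √3) • Measure.dirac 1

/-! A pair (bracketing, valuation) is a binary tree with leaves labelled by truth values, so all
entries together have a rescaled Catalan generating function, singular at `ρ = 1/(4m)`. An
implication takes a value `k` below the top exactly when its consequent is `k` and its antecedent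
exceeds `k`. With `P`, `t`, `a` the generating functions of the entries that are `≥ k`, `> k`, `=
k`, this says `a = x + t a` and `P = t + a`, hence `P = t + x / (1 - t)`.

Put `u_k = 1 - P(ρ)` for level `k`. The equation gives `u_0 = 1/2` and `(u_{k+1} - u_k) u_{k+1} =
ρ`. Linearizing it at the singularity shows that passing from tail `k` to tail `k+1` multiplies the
limiting proportion by `u_{k+1}^2 / (u_{k+1}^2 + ρ)` (`transfer_level`). The analytic input is
`tendsto_div_catalanWeight_of_recurrence`, a real-variable substitute for singularity analysis:
coefficients are compared with the Catalan weights, and the error contracts because `P(ρ) ≤ 1/2`.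

For large `m` the recursion is a discretized differential equation: `u_k^2` is close to `1/4 + 2kρ`
(`tailComplement_sq_bounds`), and `2 u_k` times the survival product is almost constant, equal to
`1` (`survival_bounds`). If `k/m → t`, then `2 u_k → √(1 + 2t)` and the survival probability tends
to `1/√(1 + 2t)`, including at `t = 1`, which gives the atom. Convergence of all tails gives
convergence in distribution. -/

namespace ImpTerm

/-! ### Terms with leaves labelled by truth values -/

/-- Relabelling of the variables of a term. -/
def map {α β : Type} (f : α → β) : ImpTerm α → ImpTerm β
  | var a => var (f a)
  | imp φ ψ => imp (φ.map f) (ψ.map f)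

theorem word_map {α β : Type} (f : α → β) (φ : ImpTerm α) : (φ.map f).word = φ.word.map f := by
  induction φ with
  | var a => rfl
  | imp φ ψ h₁ h₂ => simp [map, word, h₁, h₂]

theorem eval_map {α : Type} {m : ℕ} (ν : α → Fin m) (φ : ImpTerm α) :
    (φ.map ν).eval id = φ.eval ν := by
  induction φ with
  | var a => rfl
  | imp φ ψ h₁ h₂ => simp [map, eval, h₁, h₂]

theorem word_length_pos {α : Type} (φ : ImpTerm α) : 0 < φ.word.length := by
  induction φ with
  | var a => simp [word]
  | imp φ ψ h₁ h₂ => simp [word]; omega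

/-- Relabelling preserves the shape of the tree, and a tree is determined by its shape and its word.
-/
theorem eq_of_map_eq {α β : Type} {f f' : α → β} {φ φ' : ImpTerm α}
    (h : φ.map f = φ'.map f') (hw : φ.word = φ'.word) : φ = φ' := by
  induction φ generalizing φ' with
  | var a =>
    cases φ' with
    | var b => simpa [word] using hw
    | imp φ ψ => simp [map] at h
  | imp φ ψ h₁ h₂ =>
    cases φ' with
    | var b => simp [map] at h
    | imp φ' ψ' =>
      simp only [map, imp.injEq] at h
      have hl : φ.word.length = φ'.word.length := by
        simpa [word_map] using congrArg (fun t => t.word.length) h.1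
      obtain ⟨e₁, e₂⟩ := List.append_inj hw hl
      rw [h₁ h.1 e₁, h₂ h.2 e₂]

theorem exists_map_eq {α β : Type} {f : α → β} (ψ : ImpTerm β) {l : List α}
    (h : l.map f = ψ.word) : ∃ φ : ImpTerm α, φ.word = l ∧ φ.map f = ψ := by
  induction ψ generalizing l with
  | var b =>
    obtain ⟨a, rfl, ha⟩ := List.map_eq_singleton_iff.1 h
    exact ⟨var a, rfl, by simp [map, ha]⟩
  | imp ψ₁ ψ₂ h₁ h₂ =>
    obtain ⟨l₁, l₂, rfl, e₁, e₂⟩ := List.map_eq_append_iff.1 h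
    obtain ⟨φ₁, rfl, rfl⟩ := h₁ e₁
    obtain ⟨φ₂, rfl, rfl⟩ := h₂ e₂
    exact ⟨imp φ₁ φ₂, rfl, rfl⟩

theorem finite_word_length (α : Type) [Finite α] (n : ℕ) :
    {φ : ImpTerm α | φ.word.length = n}.Finite := by
  induction n using Nat.strong_induction_on with
  | _ n ih =>
    have h1 : (range (var : α → ImpTerm α)).Finite := finite_range _
    have h2 : (⋃ i ∈ Finset.range n, ⋃ j ∈ Finset.range n, image2 imp
        {φ : ImpTerm α | φ.word.length = i} {φ : ImpTerm α | φ.word.length = j}).Finite := by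
      refine Set.Finite.biUnion (Finset.finite_toSet _) fun i hi =>
        Set.Finite.biUnion (Finset.finite_toSet _) fun j hj => ?_
      exact (ih i (by simpa using hi)).image2 _ (ih j (by simpa using hj))
    refine (h1.union h2).subset ?_
    rintro (a | ⟨φ, ψ⟩) h
    · exact Or.inl ⟨a, rfl⟩
    · right
      have := φ.word_length_pos
      have := ψ.word_length_pos
      simp only [word, mem_ofPred_eq, List.length_append] at h
      simp only [mem_iUnion, Finset.mem_range]
      exact ⟨φ.word.length, by omega, ψ.word.length, by omega, φ, rfl, ψ, rfl, rfl⟩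

/-- The terms over the truth values with `n` leaves and value `k`. -/
noncomputable def withValue (m n : ℕ) (k : Fin m) : Finset (ImpTerm (Fin m)) :=
  ((finite_word_length (Fin m) n).subset
    (fun _ h => h.1 : {φ : ImpTerm (Fin m) | φ.word.length = n ∧ φ.eval id = k} ⊆ _)).toFinset

theorem mem_withValue {m n : ℕ} {k : Fin m} {φ : ImpTerm (Fin m)} :
    φ ∈ withValue m n k ↔ φ.word.length = n ∧ φ.eval id = k := by
  simp [withValue]

end ImpTerm

open ImpTerm

/-! ### Recurrences for the counts -/

/-- Since the variables are distinct, substituting the valuation into the bracketing loses nothing.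
Labelled trees, unlike bracketings on `Fin n`, split at the root without renumbering of variables.
-/
theorem levelCount_eq_card (m n : ℕ) (k : Fin m) : levelCount m n k = (withValue m n k).card := by
  rw [levelCount, ← Set.ncard_coe_finset]
  refine Set.ncard_congr (fun r _ => r.1.map r.2) ?_ ?_ ?_
  · rintro ⟨φ, ν⟩ ⟨h₁, h₂⟩
    have h₁ : φ.word = List.finRange n := h₁
    simp only [Finset.mem_coe, mem_withValue, word_map, eval_map]
    exact ⟨by simp [h₁], h₂⟩
  · rintro ⟨φ, ν⟩ ⟨φ', ν'⟩ ⟨h₁, _⟩ ⟨h₁', _⟩ h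
    have h₁ : φ.word = List.finRange n := h₁
    have h₁' : φ'.word = List.finRange n := h₁'
    have h : φ.map ν = φ'.map ν' := h
    have e : φ = φ' := eq_of_map_eq h (h₁.trans h₁'.symm)
    have hw := congrArg word h
    rw [word_map, word_map, h₁, h₁', ← List.ofFn_eq_map, ← List.ofFn_eq_map] at hw
    rw [e, List.ofFn_injective hw]
  · intro ψ hψ
    obtain ⟨h₁, h₂⟩ := mem_withValue.1 (Finset.mem_coe.1 hψ)
    subst h₁
    obtain ⟨φ, hφ, hψ'⟩ := exists_map_eq (f := ψ.word.get) (l := List.finRange _) ψ (by simp)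
    exact ⟨⟨φ, _⟩, ⟨hφ, by rwa [← hψ', eval_map] at h₂⟩, hψ'⟩

theorem levelCount_zero (m : ℕ) (k : Fin m) : levelCount m 0 k = 0 := by
  rw [levelCount_eq_card, Finset.card_eq_zero, Finset.eq_empty_iff_forall_notMem]
  intro φ h
  have := φ.word_length_pos
  have := (mem_withValue.1 h).1
  omega

theorem levelCount_one (m : ℕ) (k : Fin m) : levelCount m 1 k = 1 := by
  rw [levelCount_eq_card, Finset.card_eq_one]
  refine ⟨var k, ?_⟩
  ext φ
  rw [mem_withValue, Finset.mem_singleton]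
  constructor
  · rintro ⟨h₁, h₂⟩
    cases φ with
    | var a => exact congrArg var h₂
    | imp φ ψ =>
      have := φ.word_length_pos
      have := ψ.word_length_pos
      simp [word] at h₁
      omega
  · rintro rfl
    exact ⟨rfl, rfl⟩

theorem levelCount_of_two_le (m n : ℕ) (hn : 2 ≤ n) (k : Fin m) :
    levelCount m n k = ∑ ij ∈ Finset.HasAntidiagonal.antidiagonal n,
      ∑ xy : Fin m × Fin m with godelImp xy.1 xy.2 = k,
        levelCount m ij.1 xy.1 * levelCount m ij.2 xy.2 := by
  classical
  simp only [levelCount_eq_card, ← Finset.card_product]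
  rw [← Finset.sum_product', ← Finset.card_sigma]
  symm
  refine Finset.card_bij (fun s _ => imp s.2.1 s.2.2) ?_ ?_ ?_
  · rintro ⟨⟨⟨i, j⟩, ⟨x, y⟩⟩, ⟨φ, ψ⟩⟩ h
    simp only [Finset.mem_sigma, Finset.mem_product, Finset.HasAntidiagonal.mem_antidiagonal,
      Finset.mem_filter, Finset.mem_univ, true_and, mem_withValue] at h
    obtain ⟨⟨h₁, h₂⟩, ⟨h₃, h₄⟩, h₅, h₆⟩ := h
    rw [mem_withValue]
    simp [word, eval, h₁, h₂, h₃, h₄, h₅, h₆]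
  · rintro ⟨⟨⟨i, j⟩, ⟨x, y⟩⟩, ⟨φ, ψ⟩⟩ h ⟨⟨⟨i', j'⟩, ⟨x', y'⟩⟩, ⟨φ', ψ'⟩⟩ h' e
    simp only [Finset.mem_sigma, Finset.mem_product, Finset.HasAntidiagonal.mem_antidiagonal,
      Finset.mem_filter, Finset.mem_univ, true_and, mem_withValue] at h h'
    obtain ⟨⟨h₁, h₂⟩, ⟨rfl, rfl⟩, rfl, rfl⟩ := h
    obtain ⟨⟨h₁', h₂'⟩, ⟨rfl, rfl⟩, rfl, rfl⟩ := h'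
    simp only [imp.injEq] at e
    obtain ⟨rfl, rfl⟩ := e
    rfl
  · intro χ h
    obtain ⟨h₁, h₂⟩ := mem_withValue.1 h
    cases χ with
    | var a => simp [word] at h₁; omega
    | imp φ ψ =>
      refine ⟨⟨⟨(φ.word.length, ψ.word.length), (φ.eval id, ψ.eval id)⟩, (φ, ψ)⟩, ?_, rfl⟩
      simp only [Finset.mem_sigma, Finset.mem_product, Finset.HasAntidiagonal.mem_antidiagonal,
        Finset.mem_filter, Finset.mem_univ, true_and, mem_withValue, and_self, and_true]
      simp only [word, List.length_append] at h₁
      exact ⟨h₁, h₂⟩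

/-- The number of truth-table entries that are at least `v_k`. -/
noncomputable def tailCount (m k n : ℕ) : ℕ :=
  ∑ j ∈ Finset.univ.filter (fun j : Fin m => k ≤ j), levelCount m n j

theorem tailCount_zero (m n : ℕ) : tailCount m 0 n = totalCount m n := by
  simp [tailCount, totalCount]

theorem tailCount_eq_add (m n : ℕ) (k : Fin m) :
    tailCount m k n = tailCount m (k + 1) n + levelCount m n k := by
  have : (Finset.univ.filter fun j : Fin m => (k : ℕ) ≤ j) =
      insert k (Finset.univ.filter fun j : Fin m => (k : ℕ) + 1 ≤ j) := by
    ext j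
    simp [Fin.ext_iff]
    omega
  rw [tailCount, this, Finset.sum_insert (by simp), add_comm, tailCount]

theorem tailCount_le (m k n : ℕ) : tailCount m k n ≤ totalCount m n :=
  Finset.sum_le_sum_of_subset (Finset.filter_subset _ _)

/-- Below the top, `x ⇒ y = k` forces `y = k` and `x > k`, because the other branch of the
implication returns the top value. These are the coefficients of `a = x + t a`. -/
theorem levelCount_recurrence (m n : ℕ) (k : Fin m) (hk : (k : ℕ) + 1 < m) :
    levelCount m n k = (if n = 1 then 1 else 0) +
      ∑ ij ∈ Finset.HasAntidiagonal.antidiagonal n,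
        tailCount m (k + 1) ij.1 * levelCount m ij.2 k := by
  rcases Nat.lt_or_ge n 2 with h | h
  · interval_cases n
    · simp [levelCount_zero]
    · simp [levelCount_zero, levelCount_one, Finset.Nat.antidiagonal_succ, tailCount]
  · rw [if_neg (by omega), zero_add, levelCount_of_two_le m n h]
    refine Finset.sum_congr rfl fun ij _ => ?_
    rw [tailCount, Finset.sum_mul]
    symm
    refine Finset.sum_bij (fun x _ => (x, k)) ?_ ?_ ?_ ?_
    · intro x hx
      simp only [Finset.mem_filter, Finset.mem_univ, true_and] at hx ⊢
      rw [godelImp, if_neg]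
      rw [Fin.le_def]
      omega
    · intro x _ y _ h
      exact (Prod.ext_iff.1 h).1
    · rintro ⟨x, y⟩ hxy
      replace hxy : godelImp x y = k := (Finset.mem_filter.1 hxy).2
      rw [godelImp] at hxy
      split_ifs at hxy with hle
      · rw [← hxy] at hk
        simp at hk
        omega
      · subst hxy
        rw [Fin.le_def] at hle
        exact ⟨x, by simp; omega, rfl⟩
    · intro x _
      rfl

theorem totalCount_recurrence (m n : ℕ) (hn : 2 ≤ n) :
    totalCount m n =
      ∑ ij ∈ Finset.HasAntidiagonal.antidiagonal n, totalCount m ij.1 * totalCount m ij.2 := by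
  simp only [totalCount, levelCount_of_two_le m n hn]
  rw [Finset.sum_comm]
  refine Finset.sum_congr rfl fun ij _ => ?_
  rw [Finset.sum_fiberwise (s := Finset.univ) (g := fun xy : Fin m × Fin m => godelImp xy.1 xy.2)
    (f := fun xy => levelCount m ij.1 xy.1 * levelCount m ij.2 xy.2), Finset.sum_mul_sum,
    ← Finset.sum_product']
  rfl

theorem totalCount_eq_zero (m : ℕ) : totalCount m 0 = 0 := by
  simp [totalCount, levelCount_zero]

theorem totalCount_succ (m n : ℕ) : totalCount m (n + 1) = m ^ (n + 1) * catalan n := by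
  induction n using Nat.strong_induction_on with
  | _ n ih =>
    rcases n with _ | n
    · simp [totalCount, levelCount_one]
    · rw [totalCount_recurrence m _ (by omega), Finset.Nat.antidiagonal_succ_succ', catalan_succ',
        Finset.mul_sum]
      simp only [totalCount_eq_zero, Finset.sum_cons, Finset.sum_map, zero_mul, mul_zero, zero_add]
      refine Finset.sum_congr rfl fun ij hij => ?_
      have := Finset.HasAntidiagonal.mem_antidiagonal.1 hij
      simp only [Function.Embedding.prodMap, Function.Embedding.coeFn_mk, Prod.map,
        Nat.succ_eq_add_one]
      rw [ih ij.1 (by omega), ih ij.2 (by omega), ← this]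
      ring

/-! ### Catalan weights -/

/-- The coefficients of the generating function `(1 - √(1 - x)) / 2` of the Catalan numbers,
rescaled to have radius of convergence one. -/
noncomputable def catalanWeight : ℕ → ℝ
  | 0 => 0
  | n + 1 => catalan n / 4 ^ (n + 1)

theorem catalanWeight_succ_pos (n : ℕ) : 0 < catalanWeight (n + 1) := by
  have h : catalan n ≠ 0 := by
    intro h
    have := succ_mul_catalan_eq_centralBinom n
    rw [h, mul_zero] at this
    exact (Nat.centralBinom_pos n).ne this
  have : 0 < catalan n := Nat.pos_of_ne_zero h
  simp only [catalanWeight]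
  positivity

theorem catalanWeight_pos {n : ℕ} (hn : 1 ≤ n) : 0 < catalanWeight n := by
  obtain ⟨k, rfl⟩ := Nat.exists_eq_add_of_le' hn
  exact catalanWeight_succ_pos k

theorem catalanWeight_nonneg (n : ℕ) : 0 ≤ catalanWeight n := by
  rcases n with _ | n
  · exact le_rfl
  · exact (catalanWeight_succ_pos n).le

theorem catalanWeight_succ_mul {n : ℕ} (hn : 1 ≤ n) :
    2 * ((n : ℝ) + 1) * catalanWeight (n + 1) = (2 * n - 1) * catalanWeight n := by
  obtain ⟨k, rfl⟩ := Nat.exists_eq_add_of_le' hn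
  have h₀ : ((k : ℝ) + 1) * catalan k = k.centralBinom := by
    exact_mod_cast succ_mul_catalan_eq_centralBinom k
  have h₁ : ((k : ℝ) + 2) * catalan (k + 1) = (k + 1).centralBinom := by
    exact_mod_cast succ_mul_catalan_eq_centralBinom (k + 1)
  have h₂ : ((k : ℝ) + 1) * (k + 1).centralBinom = 2 * (2 * k + 1) * k.centralBinom := by
    exact_mod_cast Nat.succ_mul_centralBinom_succ k
  have h₃ : ((k : ℝ) + 2) * catalan (k + 1) = 2 * (2 * k + 1) * catalan k := by
    have hk : ((k : ℝ) + 1) ≠ 0 := by positivity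
    apply mul_left_cancel₀ hk
    rw [h₁, h₂, ← h₀]
    ring
  simp only [catalanWeight]
  push_cast
  rw [pow_succ (4 : ℝ) (k + 1)]
  field_simp
  linear_combination 2 * h₃

theorem catalanWeight_ratio {n : ℕ} (hn : 1 ≤ n) :
    catalanWeight (n + 1) / catalanWeight n = 1 - 3 / 2 * (1 / ((n : ℝ) + 1)) := by
  have := catalanWeight_succ_mul hn
  have hp := (catalanWeight_pos hn).ne'
  field_simp
  linarith

theorem tendsto_catalanWeight_succ_div :
    Tendsto (fun n => catalanWeight (n + 1) / catalanWeight n) atTop (𝓝 1) := by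
  have h : Tendsto (fun n : ℕ => 1 - 3 / 2 * (1 / ((n : ℝ) + 1))) atTop (𝓝 (1 - 3 / 2 * 0)) :=
    (tendsto_one_div_add_atTop_nhds_zero_nat.const_mul _).const_sub _
  rw [mul_zero, sub_zero] at h
  refine h.congr' ?_
  filter_upwards [eventually_ge_atTop 1] with n hn
  exact (catalanWeight_ratio hn).symm

theorem tendsto_catalanWeight_sub_div (i : ℕ) :
    Tendsto (fun n => catalanWeight (n - i) / catalanWeight n) atTop (𝓝 1) := by
  rw [← tendsto_add_atTop_iff_nat i]
  simp only [Nat.add_sub_cancel]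
  induction i with
  | zero =>
    refine tendsto_const_nhds.congr' ?_
    filter_upwards [eventually_ge_atTop 1] with n hn
    simp [(catalanWeight_pos hn).ne']
  | succ i ih =>
    have h := ih.mul ((tendsto_catalanWeight_succ_div.comp (tendsto_add_atTop_nat i)).inv₀
      one_ne_zero)
    rw [inv_one, mul_one] at h
    refine h.congr' ?_
    filter_upwards [eventually_ge_atTop 1] with n hn
    have := (catalanWeight_pos (show 1 ≤ n + i by omega)).ne'
    simp only [Function.comp, inv_div]
    rw [div_mul_div_cancel₀ this, add_assoc]

/-- The weights decay like `n ^ (-3/2)`, so the factor `n ^ 2` overcompensates. This yields the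
uniform bound `catalanWeight_sub_le` that dominates half convolutions. -/
theorem monotone_sq_mul_catalanWeight : Monotone fun n : ℕ => (n : ℝ) ^ 2 * catalanWeight n := by
  refine monotone_nat_of_le_succ fun n => ?_
  rcases Nat.eq_zero_or_pos n with rfl | hn
  · simp [(catalanWeight_nonneg _)]
  · have h := catalanWeight_succ_mul hn
    have hp := catalanWeight_pos hn
    have h1 : (1 : ℝ) ≤ n := by exact_mod_cast hn
    have : (((n + 1 : ℕ) : ℝ)) ^ 2 * catalanWeight (n + 1) =
        (n + 1) * ((2 * n - 1) * catalanWeight n) / 2 := by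
      rw [← h]
      push_cast
      ring
    simp only [this]
    nlinarith

theorem catalanWeight_sub_le {n i : ℕ} (hi : i ≤ n / 2) :
    catalanWeight (n - i) ≤ 4 * catalanWeight n := by
  rcases Nat.eq_zero_or_pos n with rfl | hn
  · simp [catalanWeight]
  have h := monotone_sq_mul_catalanWeight (Nat.sub_le n i)
  have h1 : (n : ℝ) ≤ 2 * (n - i : ℕ) := by
    have : n ≤ 2 * (n - i) := by omega
    exact_mod_cast this
  have h0 : (0 : ℝ) < n := by exact_mod_cast hn
  have h2 : (n : ℝ) ^ 2 ≤ 4 * ((n - i : ℕ) : ℝ) ^ 2 := by nlinarith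
  have h3 := mul_le_mul_of_nonneg_right h2 (catalanWeight_nonneg (n - i))
  have h4 : (n : ℝ) ^ 2 * catalanWeight (n - i) ≤ (n : ℝ) ^ 2 * (4 * catalanWeight n) := by
    simp only at h
    linarith
  exact le_of_mul_le_mul_left h4 (by positivity)

/-- The sum telescopes: `catalanWeight_succ_mul` says `c_i = 2 i c_i - 2 (i + 1) c_{i+1}` for `i ≥
1`. -/
theorem sum_catalanWeight (n : ℕ) :
    ∑ i ∈ Finset.range (n + 1), catalanWeight i =
      1 / 2 - 2 * ((n : ℝ) + 1) * catalanWeight (n + 1) := by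
  induction n with
  | zero => simp [catalanWeight]; norm_num
  | succ n ih =>
    have h := catalanWeight_succ_mul (show 1 ≤ n + 1 by omega)
    rw [Finset.sum_range_succ, ih, h]
    push_cast
    ring

theorem tendsto_mul_catalanWeight :
    Tendsto (fun n : ℕ => ((n : ℝ) + 1) * catalanWeight (n + 1)) atTop (𝓝 0) := by
  have hb (n : ℕ) : (((n : ℝ) + 1) * catalanWeight (n + 1)) ^ 2 ≤ 1 / (n + 1) := by
    -- The cube matches the decay `n ^ (-3/2)` and can be bounded by induction without Stirling's
    -- formula.
    have key : ((n : ℝ) + 1) ^ 3 * catalanWeight (n + 1) ^ 2 ≤ 1 := by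
      induction n with
      | zero => simp [catalanWeight]; norm_num
      | succ n ih =>
        have h := catalanWeight_succ_mul (show 1 ≤ n + 1 by omega)
        have hn : (0 : ℝ) ≤ n := n.cast_nonneg
        push_cast at h ⊢
        set a := catalanWeight (n + 1)
        set b := catalanWeight (n + 1 + 1)
        have e : 4 * (((n : ℝ) + 1 + 1) ^ 3 * b ^ 2) = (n + 2) * (2 * n + 1) ^ 2 * a ^ 2 := by
          linear_combination (n + 2) * (2 * (↑n + 1 + 1) * b + (2 * (↑n + 1) - 1) * a) * h
        have f : ((n : ℝ) + 2) * (2 * n + 1) ^ 2 ≤ 4 * (n + 1) ^ 3 := by nlinarith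
        nlinarith [mul_le_mul_of_nonneg_right f (sq_nonneg a)]
    rw [le_div_iff₀ (by positivity)]
    linarith
  have h := squeeze_zero (fun n => sq_nonneg _) hb tendsto_one_div_add_atTop_nhds_zero_nat
  have h' := h.sqrt
  rw [Real.sqrt_zero] at h'
  refine h'.congr fun n => Real.sqrt_sq ?_
  have := catalanWeight_nonneg (n + 1)
  positivity

theorem hasSum_catalanWeight : HasSum catalanWeight (1 / 2) := by
  rw [hasSum_iff_tendsto_nat_of_nonneg catalanWeight_nonneg, ← tendsto_add_atTop_iff_nat 1]
  have h := (tendsto_mul_catalanWeight.const_mul 2).const_sub (1 / 2)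
  rw [mul_zero, sub_zero] at h
  refine h.congr fun n => ?_
  rw [sum_catalanWeight]
  ring

/-! ### Transfer of asymptotics through a convolution equation -/

/-- The first half of a convolution with a summable sequence, relative to the Catalan weights. -/
theorem tendsto_half_convolution {f h : ℕ → ℝ} {β : ℝ} (hf : ∀ n, 0 ≤ f n) (hs : Summable f)
    (hh : ∀ n, |h n| ≤ catalanWeight n)
    (hβ : Tendsto (fun n => h n / catalanWeight n) atTop (𝓝 β)) {N : ℕ → ℕ}
    (hN : ∀ n, N n ≤ n / 2) (hN' : Tendsto N atTop atTop) :
    Tendsto (fun n => (∑ i ∈ Finset.range (N n + 1), f i * h (n - i)) / catalanWeight n) atTop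
      (𝓝 ((∑' n, f n) * β)) := by
  have key : Tendsto (fun n => ∑' i, if i ∈ Finset.range (N n + 1) then
      f i * h (n - i) / catalanWeight n else 0) atTop (𝓝 (∑' i, f i * β)) := by
    -- The `4` is the constant of `catalanWeight_sub_le`, available since only `i ≤ n / 2` occurs.
    refine tendsto_tsum_of_dominated_convergence (bound := fun i => f i * 4) (hs.mul_right 4) ?_ ?_
    · intro i
      have h₁ : Tendsto (fun n => h (n - i) / catalanWeight (n - i)) atTop (𝓝 β) :=
        hβ.comp (tendsto_sub_atTop_nat i)
      have h₂ := (h₁.mul (tendsto_catalanWeight_sub_div i)).const_mul (f i)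
      rw [mul_one] at h₂
      refine h₂.congr' ?_
      filter_upwards [hN'.eventually_ge_atTop i, eventually_ge_atTop (i + 1)] with n hn hn'
      have := (catalanWeight_pos (show 1 ≤ n - i by omega)).ne'
      rw [if_pos (by simpa using Nat.lt_succ_of_le hn), div_mul_div_cancel₀ this, mul_div_assoc]
    · filter_upwards [eventually_ge_atTop 1] with n hn i
      have hp := catalanWeight_pos hn
      split_ifs with hi
      · have hi' : i ≤ n / 2 := (Nat.lt_succ_iff.1 (Finset.mem_range.1 hi)).trans (hN n)
        rw [Real.norm_eq_abs, abs_div, abs_mul, abs_of_nonneg (hf i), abs_of_pos hp, mul_div_assoc]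
        refine mul_le_mul_of_nonneg_left ?_ (hf i)
        rw [div_le_iff₀ hp]
        exact (hh _).trans (catalanWeight_sub_le hi')
      · rw [norm_zero]
        have := hf i
        positivity
  rw [tsum_mul_right] at key
  refine key.congr fun n => ?_
  rw [tsum_eq_sum (s := Finset.range (N n + 1)) fun i hi => if_neg hi, Finset.sum_div]
  exact Finset.sum_congr rfl fun i hi => if_pos hi

/-- In each half the factor with the large index has index at least `n / 2`, as
`tendsto_half_convolution` requires. The bound `(n - 1) / 2` keeps the middle term of an even `n`
from being counted twice. -/
theorem sum_antidiagonal_eq_half_add_half {n : ℕ} (hn : 1 ≤ n) (f h : ℕ → ℝ) :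
    ∑ ij ∈ Finset.HasAntidiagonal.antidiagonal n, f ij.1 * h ij.2 =
      ∑ i ∈ Finset.range (n / 2 + 1), f i * h (n - i) +
        ∑ j ∈ Finset.range ((n - 1) / 2 + 1), h j * f (n - j) := by
  rw [Finset.Nat.sum_antidiagonal_eq_sum_range_succ (fun i j => f i * h j)]
  have e : n.succ = (n / 2 + 1) + ((n - 1) / 2 + 1) := by omega
  rw [e, Finset.sum_range_add, ← Finset.sum_range_reflect (fun j => h j * f (n - j))]
  congr 1
  refine Finset.sum_congr rfl fun i hi => ?_
  rw [Finset.mem_range] at hi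
  rw [mul_comm]
  congr 2 <;> omega

theorem tendsto_zero_of_contraction {v : ℕ → ℝ} (hv : ∀ n, 0 ≤ v n) {C : ℝ} (hC : 0 < C)
    (h₀ : ∀ᶠ n in atTop, v n ≤ C)
    (h : ∀ D > 0, (∀ᶠ n in atTop, v n ≤ D) → ∀ᶠ n in atTop, v n ≤ 3 / 4 * D) :
    Tendsto v atTop (𝓝 0) := by
  have hk (k : ℕ) : ∀ᶠ n in atTop, v n ≤ (3 / 4) ^ k * C := by
    induction k with
    | zero => simpa using h₀
    | succ k ih =>
      filter_upwards [h _ (by positivity) ih] with n hn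
      rw [pow_succ']
      linarith
  have hlim : Tendsto (fun k : ℕ => (3 / 4 : ℝ) ^ k * C) atTop (𝓝 (0 * C)) :=
    (tendsto_pow_atTop_nhds_zero_of_lt_one (by norm_num) (by norm_num)).mul_const C
  rw [zero_mul] at hlim
  refine tendsto_order.2 ⟨fun b hb => Eventually.of_forall fun n => hb.trans_le (hv n),
    fun b hb => ?_⟩
  obtain ⟨k, hk'⟩ := (hlim.eventually_lt_const hb).exists
  filter_upwards [hk k] with n hn
  exact hn.trans_lt hk'

/-- Transfer of asymptotics relative to the Catalan weights through the equation `a = r x + t a`,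
where `t + a` is known. -/
theorem tendsto_div_catalanWeight_of_recurrence {a t P : ℕ → ℝ} {r p : ℝ} (ha : ∀ n, 0 ≤ a n)
    (ht : ∀ n, 0 ≤ t n) (hP : ∀ n, P n = t n + a n) (hc : ∀ n, P n ≤ catalanWeight n)
    (hrec : ∀ n, a n = (if n = 1 then r else 0) +
      ∑ ij ∈ Finset.HasAntidiagonal.antidiagonal n, t ij.1 * a ij.2)
    (hp : Tendsto (fun n => P n / catalanWeight n) atTop (𝓝 p)) :
    (∑' n, P n) ≤ 1 / 2 ∧ 0 ≤ ∑' n, a n ∧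
    (∑' n, a n) * (1 - ∑' n, P n + ∑' n, a n) = r ∧
    Tendsto (fun n => a n / catalanWeight n) atTop
      (𝓝 ((∑' n, a n) * p / (1 - (∑' n, P n) + 2 * ∑' n, a n))) := by
  have hw := hasSum_catalanWeight
  have sa : Summable a := hw.summable.of_nonneg_of_le ha fun n => by
    linarith [hc n, hP n, ht n]
  have st : Summable t := hw.summable.of_nonneg_of_le ht fun n => by
    linarith [hc n, hP n, ha n]
  have eP : ∑' n, P n = ∑' n, t n + ∑' n, a n := by
    rw [← st.tsum_add sa]
    exact tsum_congr hP
  have sP : Summable P := (st.add sa).congr fun n => (hP n).symm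
  have hA : 0 ≤ ∑' n, a n := tsum_nonneg ha
  have hT : 0 ≤ ∑' n, t n := tsum_nonneg ht
  have hB : ∑' n, P n ≤ 1 / 2 := by
    rw [← hw.tsum_eq]
    exact sP.tsum_le_tsum hc hw.summable
  have hmul : ∑' n, a n = r + (∑' n, t n) * ∑' n, a n := by
    have h₁ : (∑' n, t n) * (∑' n, a n) =
        ∑' n, ∑ ij ∈ Finset.HasAntidiagonal.antidiagonal n, t ij.1 * a ij.2 :=
      tsum_mul_tsum_eq_tsum_sum_antidiagonal_of_summable_norm
        (by simpa using st.abs) (by simpa using sa.abs)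
    have h₃ : HasSum (fun n : ℕ => if n = 1 then r else 0) r := hasSum_ite_eq 1 r
    have h₂ : Summable fun n => ∑ ij ∈ Finset.HasAntidiagonal.antidiagonal n, t ij.1 * a ij.2 :=
      (sa.sub h₃.summable).congr fun n => by rw [hrec n, add_sub_cancel_left]
    calc ∑' n, a n = ∑' n, ((if n = 1 then r else 0) +
          ∑ ij ∈ Finset.HasAntidiagonal.antidiagonal n, t ij.1 * a ij.2) := tsum_congr hrec
      _ = r + (∑' n, t n) * (∑' n, a n) := by
          rw [h₃.summable.tsum_add h₂, h₃.tsum_eq, h₁]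
  set A := ∑' n, a n
  set T := ∑' n, t n
  refine ⟨hB, hA, by rw [eP]; linear_combination hmul, ?_⟩
  have hden : 0 < 1 - (∑' n, P n) + 2 * A := by linarith
  -- If `a n / c n → α`, then `t n / c n → p - α`, and the recurrence forces `α = T α + A (p - α)`.
  -- This is the solution, as `∑ P = T + A`.
  set α := A * p / (1 - (∑' n, P n) + 2 * A) with hα
  have hαeq : α * (1 - T + A) = A * p := by
    have : α * (1 - (∑' n, P n) + 2 * A) = A * p :=
      div_mul_cancel₀ _ hden.ne'
    rw [eP] at this
    linear_combination this
  set e : ℕ → ℝ := fun n => a n - α * catalanWeight n with he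
  set M : ℕ → ℕ := fun n => n / 2 with hM
  set N : ℕ → ℕ := fun n => (n - 1) / 2 with hN
  have hM' : Tendsto M atTop atTop := Nat.tendsto_div_const_atTop (by norm_num)
  have hN' : Tendsto N atTop atTop := hM'.comp (tendsto_sub_atTop_nat 1)
  have hMle : ∀ n, M n ≤ n / 2 := fun n => le_rfl
  have hNle : ∀ n, N n ≤ n / 2 := fun n => Nat.div_le_div_right (Nat.sub_le _ _)
  have hcc : Tendsto (fun n => catalanWeight n / catalanWeight n) atTop (𝓝 1) :=
    tendsto_catalanWeight_sub_div 0
  have hcabs : ∀ n, |catalanWeight n| ≤ catalanWeight n := fun n =>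
    (abs_of_nonneg (catalanWeight_nonneg n)).le
  have hPabs : ∀ n, |P n| ≤ catalanWeight n := fun n => by
    rw [abs_of_nonneg (by rw [hP]; exact add_nonneg (ht n) (ha n))]
    exact hc n
  have l₁ := tendsto_half_convolution ht st hcabs hcc hMle hM'
  have l₂ := tendsto_half_convolution ha sa hcabs hcc hNle hN'
  have l₃ := tendsto_half_convolution ha sa hPabs hp hNle hN'
  rw [mul_one] at l₁ l₂
  set s₁ : ℕ → ℝ := fun n => ∑ i ∈ Finset.range (M n + 1), t i * catalanWeight (n - i)
  set s₂ : ℕ → ℝ := fun n => ∑ i ∈ Finset.range (N n + 1), a i * catalanWeight (n - i)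
  set s₃ : ℕ → ℝ := fun n => ∑ i ∈ Finset.range (N n + 1), a i * P (n - i)
  -- The limit is `α T + A p - α A - α`, which vanishes by the choice of `α`.
  have hR : Tendsto (fun n => |α * (s₁ n / catalanWeight n) + s₃ n / catalanWeight n
      - α * (s₂ n / catalanWeight n) - α * (catalanWeight n / catalanWeight n)|) atTop (𝓝 0) := by
    have := ((((l₁.const_mul α).add l₃).sub (l₂.const_mul α)).sub (hcc.const_mul α)).abs
    convert this using 2
    symm
    rw [abs_eq_zero]
    linear_combination -hαeq
  have hS : Tendsto (fun n => s₁ n / catalanWeight n + s₂ n / catalanWeight n) atTop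
      (𝓝 (T + A)) := l₁.add l₂
  -- Substitute `a = α c + e` at large indices, and `t = P - a` in the second half. The error then
  -- satisfies a linear recurrence with coefficients `t` and `a`, of total mass `T + A ≤ 1/2`, up to
  -- a remainder controlled by `hR`.
  have hdecomp (n : ℕ) (hn : 2 ≤ n) : e n =
      ∑ i ∈ Finset.range (M n + 1), t i * e (n - i)
      - ∑ i ∈ Finset.range (N n + 1), a i * e (n - i)
      + (α * s₁ n + s₃ n - α * s₂ n - α * catalanWeight n) := by
    have h₁ : ∑ i ∈ Finset.range (M n + 1), t i * e (n - i) =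
        ∑ i ∈ Finset.range (M n + 1), t i * a (n - i) - α * s₁ n := by
      simp only [e, s₁, mul_sub, Finset.sum_sub_distrib, Finset.mul_sum]
      congr 1
      exact Finset.sum_congr rfl fun i _ => by ring
    have h₂ : ∑ i ∈ Finset.range (N n + 1), a i * e (n - i) =
        ∑ i ∈ Finset.range (N n + 1), a i * a (n - i) - α * s₂ n := by
      simp only [e, s₂, mul_sub, Finset.sum_sub_distrib, Finset.mul_sum]
      congr 1
      exact Finset.sum_congr rfl fun i _ => by ring
    have h₃ : s₃ n = ∑ i ∈ Finset.range (N n + 1), a i * t (n - i) +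
        ∑ i ∈ Finset.range (N n + 1), a i * a (n - i) := by
      simp only [s₃, hP, mul_add, Finset.sum_add_distrib]
    have h₄ := hrec n
    rw [if_neg (by omega), zero_add, sum_antidiagonal_eq_half_add_half (by omega)] at h₄
    simp only [h₁, h₂, h₃]
    simp only [e]
    rw [h₄]
    ring
  have hv : Tendsto (fun n => |e n| / catalanWeight n) atTop (𝓝 0) := by
    refine tendsto_zero_of_contraction (C := 1 + |α|)
      (fun n => div_nonneg (abs_nonneg _) (catalanWeight_nonneg n)) (by positivity) ?_ ?_
    · filter_upwards [eventually_ge_atTop 1] with n hn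
      rw [div_le_iff₀ (catalanWeight_pos hn)]
      have h₁ : |e n| ≤ |a n| + |α * catalanWeight n| := abs_sub _ _
      rw [abs_mul, abs_of_nonneg (ha n), abs_of_nonneg (catalanWeight_nonneg n)] at h₁
      linarith [hc n, hP n, ht n]
    · intro D hD hev
      obtain ⟨k, hk⟩ := eventually_atTop.1 hev
      have hk' : ∀ n, k ≤ n → 1 ≤ n → |e n| ≤ D * catalanWeight n := fun n h₁ h₂ =>
        (div_le_iff₀ (catalanWeight_pos h₂)).1 (hk n h₁)
      have hTA : T + A ≤ 1 / 2 := eP ▸ hB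
      -- The contraction factor `3/4` is `5/8` from the two sums plus `1/8` from the remainder. With
      -- `n ≥ 2 k + 2`, every index `n - i` with `i ≤ n / 2` is at least `k + 1`, where the bound
      -- `D` holds.
      filter_upwards [hS.eventually_lt_const (show T + A < 5 / 8 by linarith),
        hR.eventually_lt_const (show (0 : ℝ) < D / 8 by positivity),
        eventually_ge_atTop (2 * k + 2)] with n h₁ h₂ hn
      have hp' := catalanWeight_pos (show 1 ≤ n by omega)
      have b₁ : |∑ i ∈ Finset.range (M n + 1), t i * e (n - i)| ≤ D * s₁ n := by
        refine (Finset.abs_sum_le_sum_abs _ _).trans ?_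
        rw [Finset.mul_sum]
        refine Finset.sum_le_sum fun i hi => ?_
        have hi' : i ≤ n / 2 := Nat.lt_succ_iff.1 (Finset.mem_range.1 hi)
        rw [abs_mul, abs_of_nonneg (ht i), mul_left_comm]
        exact mul_le_mul_of_nonneg_left (hk' _ (by omega) (by omega)) (ht i)
      have b₂ : |∑ i ∈ Finset.range (N n + 1), a i * e (n - i)| ≤ D * s₂ n := by
        refine (Finset.abs_sum_le_sum_abs _ _).trans ?_
        rw [Finset.mul_sum]
        refine Finset.sum_le_sum fun i hi => ?_
        have hi' : i ≤ n / 2 := (Nat.lt_succ_iff.1 (Finset.mem_range.1 hi)).trans (hNle n)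
        rw [abs_mul, abs_of_nonneg (ha i), mul_left_comm]
        exact mul_le_mul_of_nonneg_left (hk' _ (by omega) (by omega)) (ha i)
      have b₃ : |α * s₁ n + s₃ n - α * s₂ n - α * catalanWeight n| ≤ D / 8 * catalanWeight n := by
        rw [← div_le_iff₀ hp', ← abs_of_pos hp', ← abs_div, abs_of_pos hp']
        refine le_trans (le_of_eq ?_) h₂.le
        congr 1
        ring
      have b₄ : s₁ n + s₂ n ≤ 5 / 8 * catalanWeight n := by
        rw [← div_le_iff₀ hp', add_div]
        exact h₁.le
      rw [div_le_iff₀ hp', hdecomp n (by omega)]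
      have b₅ := mul_le_mul_of_nonneg_left b₄ hD.le
      refine (abs_add_le _ _).trans ?_
      have b₆ := abs_sub (∑ i ∈ Finset.range (M n + 1), t i * e (n - i))
        (∑ i ∈ Finset.range (N n + 1), a i * e (n - i))
      linarith
  rw [tendsto_iff_norm_sub_tendsto_zero]
  refine hv.congr' ?_
  filter_upwards [eventually_ge_atTop 1] with n hn
  have hp' := catalanWeight_pos hn
  rw [Real.norm_eq_abs, div_sub' hp'.ne', abs_div, abs_of_pos hp', mul_comm]

/-! ### Generating functions at the dominant singularity -/

theorem totalCount_mul_pow {m : ℕ} (hm : 1 ≤ m) (n : ℕ) :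
    (totalCount m n : ℝ) * (1 / (4 * m)) ^ n = catalanWeight n := by
  have h0 : (m : ℝ) ≠ 0 := by positivity
  rcases n with _ | n
  · simp [totalCount_eq_zero, catalanWeight]
  · rw [totalCount_succ, catalanWeight]
    push_cast
    rw [div_pow, mul_pow, one_pow]
    field_simp

/-- The value at the dominant singularity of one minus the generating function of the entries that
are at least `v_k`. -/
noncomputable def tailComplement (m k : ℕ) : ℝ :=
  1 - ∑' n : ℕ, (tailCount m k n : ℝ) * (1 / (4 * m)) ^ n

/-- The limiting proportion of entries that are at least `v_k`, as a product. -/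
noncomputable def survival (m : ℕ) : ℕ → ℝ
  | 0 => 1
  | k + 1 => survival m k * (tailComplement m (k + 1) ^ 2 /
      (tailComplement m (k + 1) ^ 2 + 1 / (4 * m)))

theorem tailComplement_zero {m : ℕ} (hm : 1 ≤ m) : tailComplement m 0 = 1 / 2 := by
  rw [tailComplement]
  simp only [tailCount_zero, totalCount_mul_pow hm]
  rw [hasSum_catalanWeight.tsum_eq]
  norm_num

/-- Evaluating `a (1 - t) = x` at `ρ` gives the relation between consecutive complements. Singular
parts transform by the derivative of `t ↦ t + ρ / (1 - t)`, which is `1 + ρ / u'^2`; its inverse is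
the factor in the limit. -/
theorem transfer_level {m k : ℕ} (hk : k + 1 < m) {p : ℝ}
    (hp : Tendsto (fun n => (tailCount m k n : ℝ) / totalCount m n) atTop (𝓝 p)) :
    1 / 2 ≤ tailComplement m k ∧ tailComplement m k ≤ tailComplement m (k + 1) ∧
    (tailComplement m (k + 1) - tailComplement m k) * tailComplement m (k + 1) = 1 / (4 * m) ∧
    Tendsto (fun n => (tailCount m (k + 1) n : ℝ) / totalCount m n) atTop
      (𝓝 (p * (tailComplement m (k + 1) ^ 2 /
        (tailComplement m (k + 1) ^ 2 + 1 / (4 * m))))) := by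
  have hm : 1 ≤ m := by omega
  have hm0 : (0 : ℝ) < m := by exact_mod_cast hm
  set ρ : ℝ := 1 / (4 * m) with hρ
  have hρ0 : 0 < ρ := by positivity
  set κ : Fin m := ⟨k, by omega⟩
  set a : ℕ → ℝ := fun n => levelCount m n κ * ρ ^ n with ha
  set t : ℕ → ℝ := fun n => tailCount m (k + 1) n * ρ ^ n with ht
  set P : ℕ → ℝ := fun n => tailCount m k n * ρ ^ n with hP
  have ha0 : ∀ n, 0 ≤ a n := fun n => by positivity
  have ht0 : ∀ n, 0 ≤ t n := fun n => by positivity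
  have hPta : ∀ n, P n = t n + a n := fun n => by
    have : (tailCount m k n : ℝ) = tailCount m (k + 1) n + levelCount m n κ := by
      exact_mod_cast tailCount_eq_add m n κ
    simp only [P, t, a, this]
    ring
  have hPc : ∀ n, P n ≤ catalanWeight n := fun n => by
    rw [← totalCount_mul_pow hm n]
    exact mul_le_mul_of_nonneg_right (by exact_mod_cast tailCount_le m k n) (by positivity)
  have hrec : ∀ n, a n = (if n = 1 then ρ else 0) +
      ∑ ij ∈ Finset.HasAntidiagonal.antidiagonal n, t ij.1 * a ij.2 := fun n => by
    have h : (levelCount m n κ : ℝ) = (if n = 1 then 1 else 0) +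
        ∑ ij ∈ Finset.HasAntidiagonal.antidiagonal n,
          (tailCount m (k + 1) ij.1 : ℝ) * levelCount m ij.2 κ := by
      exact_mod_cast levelCount_recurrence m n κ hk
    simp only [a, t, h, add_mul, Finset.sum_mul]
    congr 1
    · split_ifs with h1
      · simp [h1]
      · simp
    · refine Finset.sum_congr rfl fun ij hij => ?_
      rw [← Finset.HasAntidiagonal.mem_antidiagonal.1 hij, pow_add]
      ring
  have hdiv : ∀ (c : ℝ) (n : ℕ), c * ρ ^ n / catalanWeight n = c / totalCount m n := fun c n => by
    rw [← totalCount_mul_pow hm n, mul_div_mul_right _ _ (by positivity)]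
  have hpP : Tendsto (fun n => P n / catalanWeight n) atTop (𝓝 p) :=
    hp.congr fun n => (hdiv _ n).symm
  obtain ⟨h₁, h₂, h₃, h₄⟩ := tendsto_div_catalanWeight_of_recurrence ha0 ht0 hPta hPc hrec hpP
  have sa : Summable a := hasSum_catalanWeight.summable.of_nonneg_of_le ha0 fun n => by
    linarith [hPc n, hPta n, ht0 n]
  have st : Summable t := hasSum_catalanWeight.summable.of_nonneg_of_le ht0 fun n => by
    linarith [hPc n, hPta n, ha0 n]
  have eP : ∑' n, P n = ∑' n, t n + ∑' n, a n := by
    rw [← st.tsum_add sa]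
    exact tsum_congr hPta
  have eu : tailComplement m k = 1 - ∑' n, P n := rfl
  have eu' : tailComplement m (k + 1) = 1 - ∑' n, t n := rfl
  set u := tailComplement m k
  set u' := tailComplement m (k + 1)
  have hA : ∑' n, a n = u' - u := by rw [eu, eu', eP]; ring
  have hu : 1 / 2 ≤ u := by rw [eu]; linarith
  rw [hA] at h₂ h₃ h₄
  rw [← eu] at h₃ h₄
  have h₃' : (u' - u) * u' = ρ := by linear_combination h₃
  refine ⟨hu, by linarith, h₃', ?_⟩
  have h₅ := hp.sub (h₄.congr fun n => hdiv _ n)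
  have hu' : 0 < u' := by linarith
  -- The left side is `p u' / (2 u' - u)`; multiply above and below by `u'` and use `(u' - u) u' =
  -- ρ`.
  have e : p - (u' - u) * p / (u + 2 * (u' - u)) = p * (u' ^ 2 / (u' ^ 2 + ρ)) := by
    have d₁ : u + 2 * (u' - u) ≠ 0 := by linarith
    have d₂ : u' ^ 2 + ρ ≠ 0 := by positivity
    field_simp
    rw [← h₃']
    ring
  rw [e] at h₅
  refine h₅.congr fun n => ?_
  have : (tailCount m k n : ℝ) = tailCount m (k + 1) n + levelCount m n κ := by
    exact_mod_cast tailCount_eq_add m n κ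
  rw [this]
  ring

theorem tendsto_tailCount_div {m k : ℕ} (hk : k < m) :
    Tendsto (fun n => (tailCount m k n : ℝ) / totalCount m n) atTop (𝓝 (survival m k)) := by
  induction k with
  | zero =>
    refine tendsto_const_nhds.congr' ?_
    filter_upwards [eventually_ge_atTop 1] with n hn
    have h : (totalCount m n : ℝ) ≠ 0 := by
      intro h
      have := totalCount_mul_pow (show 1 ≤ m by omega) n
      rw [h, zero_mul] at this
      exact (catalanWeight_pos hn).ne this
    rw [tailCount_zero, div_self h, survival]
  | succ k ih => exact (transfer_level hk (ih (by omega))).2.2.2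

theorem tailComplement_step {m k : ℕ} (hk : k + 1 < m) :
    1 / 2 ≤ tailComplement m k ∧ tailComplement m k ≤ tailComplement m (k + 1) ∧
    (tailComplement m (k + 1) - tailComplement m k) * tailComplement m (k + 1) = 1 / (4 * m) := by
  obtain ⟨h₁, h₂, h₃, _⟩ := transfer_level hk (tendsto_tailCount_div (by omega))
  exact ⟨h₁, h₂, h₃⟩

/-! ### Limiting proportions for fixed `m` -/

/-- A level is the difference of two consecutive tails, and the top level is itself a tail, so a
limit exists and `limUnder` picks it. -/
theorem tendsto_levelProportion (m : ℕ) (k : Fin m) :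
    Tendsto (fun n => levelProportion m n k) atTop (𝓝 (limitProportion m k)) := by
  have h : ∃ l, Tendsto (fun n => levelProportion m n k) atTop (𝓝 l) := by
    by_cases hk : (k : ℕ) + 1 < m
    · refine ⟨_, ((tendsto_tailCount_div k.2).sub (tendsto_tailCount_div hk)).congr fun n => ?_⟩
      rw [levelProportion, tailCount_eq_add]
      push_cast
      ring
    · refine ⟨_, (tendsto_tailCount_div k.2).congr fun n => ?_⟩
      have : tailCount m (k + 1) n = 0 := by
        rw [tailCount, Finset.filter_false_of_mem, Finset.sum_empty]
        intro j _
        omega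
      rw [levelProportion, tailCount_eq_add, this, zero_add]
  exact tendsto_nhds_limUnder h

theorem limitProportion_nonneg (m : ℕ) (k : Fin m) : 0 ≤ limitProportion m k :=
  ge_of_tendsto' (tendsto_levelProportion m k) fun n => by
    rw [levelProportion]
    positivity

theorem sum_limitProportion_eq_survival {m k : ℕ} (hk : k < m) :
    ∑ j ∈ Finset.univ.filter (fun j : Fin m => k ≤ j), limitProportion m j = survival m k := by
  have h := tendsto_finsetSum (Finset.univ.filter (fun j : Fin m => k ≤ j))
    fun j _ => tendsto_levelProportion m j
  refine tendsto_nhds_unique h ((tendsto_tailCount_div hk).congr fun n => ?_)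
  simp only [levelProportion]
  rw [← Finset.sum_div, tailCount]
  push_cast
  rfl

theorem sum_limitProportion {m : ℕ} (hm : 1 ≤ m) : ∑ k : Fin m, limitProportion m k = 1 := by
  have := sum_limitProportion_eq_survival (show 0 < m by omega)
  simpa [survival] using this

/-! ### Asymptotics as the number of truth values grows -/

/-- From `(u' - u) u' = ρ` follows `u'^2 = u^2 + 2 ρ - (u' - u)^2`, and `u' ≥ 1/2` gives `u' - u ≤ 2
ρ`. Each step thus adds `2 ρ` with a defect of at most `4 ρ^2`. -/
theorem tailComplement_sq_bounds {m k : ℕ} (hk : k < m) :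
    1 / 2 ≤ tailComplement m k ∧
    tailComplement m k ^ 2 ≤ 1 / 4 + 2 * k * (1 / (4 * m)) ∧
    1 / 4 + 2 * k * (1 / (4 * m)) - 4 * k * (1 / (4 * m)) ^ 2 ≤ tailComplement m k ^ 2 := by
  induction k with
  | zero =>
    rw [tailComplement_zero (by omega)]
    norm_num
  | succ k ih =>
    obtain ⟨h₁, h₂, h₃⟩ := ih (by omega)
    obtain ⟨-, h₄, h₅⟩ := tailComplement_step hk
    set x : ℝ := 1 / (4 * m)
    set u := tailComplement m k
    set u' := tailComplement m (k + 1)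
    have e : u' ^ 2 = u ^ 2 + 2 * x - (u' - u) ^ 2 := by linear_combination 2 * h₅
    have hx : (u' - u) ≤ 2 * x := by nlinarith
    have hx2 : (u' - u) ^ 2 ≤ (2 * x) ^ 2 := pow_le_pow_left₀ (by linarith) hx 2
    push_cast
    refine ⟨by linarith, by nlinarith [sq_nonneg (u' - u)], by linarith⟩

/-- The quantity `2 * survival * tailComplement` starts at `1` and is nearly conserved: one step
divides it by `1 - ρ^2 / u'^4`, where `u' ≥ 1/2` gives `ρ^2 / u'^4 ≤ 16 ρ^2`. -/
theorem survival_bounds {m k : ℕ} (hk : k < m) :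
    1 ≤ 2 * survival m k * tailComplement m k ∧
    2 * survival m k * tailComplement m k * (1 - 16 * k * (1 / (4 * m)) ^ 2) ≤ 1 := by
  induction k with
  | zero =>
    rw [tailComplement_zero (by omega), survival]
    norm_num
  | succ k ih =>
    obtain ⟨h₁, h₂⟩ := ih (by omega)
    obtain ⟨h₃, h₄, h₅⟩ := tailComplement_step hk
    have hm : (2 : ℝ) ≤ m := by exact_mod_cast (show 2 ≤ m by omega)
    have hx0 : (0 : ℝ) < 1 / (4 * m) := by positivity
    have hx1 : (1 : ℝ) / (4 * m) ≤ 1 / 8 := by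
      apply one_div_le_one_div_of_le <;> linarith
    rw [survival]
    set x : ℝ := 1 / (4 * m)
    set u := tailComplement m k
    set u' := tailComplement m (k + 1)
    set d := survival m k
    have hu' : 1 / 2 ≤ u' := h₃.trans h₄
    have hQ : 1 / 4 ≤ u' ^ 2 := by nlinarith
    have hu : u * u' = u' ^ 2 - x := by linear_combination -h₅
    set y : ℝ := x ^ 2 / u' ^ 4 with hy
    have hy0 : 0 ≤ y := by positivity
    have hy1 : y ≤ 16 * x ^ 2 := by
      rw [hy, div_le_iff₀ (by positivity)]
      have : 1 / 16 ≤ u' ^ 4 := by nlinarith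
      nlinarith [sq_nonneg x]
    have hy2 : 0 < 1 - y := by nlinarith
    -- With `u = (u'^2 - x) / u'` this is `(u'^2 - x) (u'^2 + x) = u'^4 - x^2`.
    have e : 2 * (d * (u' ^ 2 / (u' ^ 2 + x))) * u' * (1 - y) = 2 * d * u := by
      have hne : u' ≠ 0 := by linarith
      have hux : u = (u' ^ 2 - x) / u' := by rw [← hu]; field_simp
      rw [hux, hy]
      have : u' ^ 2 + x ≠ 0 := by positivity
      field_simp
      ring
    set z := 2 * (d * (u' ^ 2 / (u' ^ 2 + x))) * u'
    rw [← e] at h₁ h₂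
    have hz : 0 < z := by
      by_contra hz
      nlinarith
    refine ⟨by nlinarith, le_trans ?_ h₂⟩
    rw [mul_assoc z (1 - y)]
    refine mul_le_mul_of_nonneg_left ?_ hz.le
    -- The discarded cross term in `(1 - y) (1 - 16 k x^2) ≥ 1 - 16 (k + 1) x^2`.
    have : (0 : ℝ) ≤ 16 * k * x ^ 2 * y := by positivity
    push_cast
    nlinarith

theorem tendsto_survival {κ : ℕ → ℕ} {t : ℝ} (ht : 0 ≤ t) (hκ : ∀ᶠ m in atTop, κ m < m)
    (hlim : Tendsto (fun m : ℕ => (κ m : ℝ) / m) atTop (𝓝 t)) :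
    Tendsto (fun m => survival m (κ m)) atTop (𝓝 (1 / √(1 + 2 * t))) := by
  have hinv : Tendsto (fun m : ℕ => 1 / (m : ℝ)) atTop (𝓝 0) := tendsto_one_div_atTop_nhds_zero_nat
  have hu2 : Tendsto (fun m => tailComplement m (κ m) ^ 2) atTop (𝓝 (1 / 4 + 1 / 2 * t)) := by
    have hup : Tendsto (fun m : ℕ => 1 / 4 + 1 / 2 * ((κ m : ℝ) / m)) atTop
        (𝓝 (1 / 4 + 1 / 2 * t)) := (hlim.const_mul _).const_add _
    have hlow := hup.sub hinv
    rw [sub_zero] at hlow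
    refine tendsto_of_tendsto_of_tendsto_of_le_of_le' hlow hup ?_ ?_
    · filter_upwards [hκ] with m hm
      have hm0 : (0 : ℝ) < m := by exact_mod_cast (show 0 < m by omega)
      have hkm : (κ m : ℝ) ≤ m := by exact_mod_cast hm.le
      refine le_trans ?_ (tailComplement_sq_bounds hm).2.2
      have h : 4 * (κ m : ℝ) * (1 / (4 * m)) ^ 2 ≤ 1 / m := by
        have : 4 * (κ m : ℝ) * (1 / (4 * m)) ^ 2 ≤ 4 * m * (1 / (4 * m)) ^ 2 := by gcongr
        refine this.trans ?_
        have e : 4 * (m : ℝ) * (1 / (4 * m)) ^ 2 = 1 / 4 * (1 / m) := by field_simp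
        have : 0 < 1 / (m : ℝ) := by positivity
        linarith
      have e : 2 * (κ m : ℝ) * (1 / (4 * m)) = 1 / 2 * (κ m / m) := by field_simp; ring
      linarith
    · filter_upwards [hκ] with m hm
      have hm0 : (0 : ℝ) < m := by exact_mod_cast (show 0 < m by omega)
      refine (tailComplement_sq_bounds hm).2.1.trans (le_of_eq ?_)
      field_simp
      ring
  have hu : Tendsto (fun m => 2 * tailComplement m (κ m)) atTop (𝓝 (√(1 + 2 * t))) := by
    have h := (hu2.const_mul 4).sqrt
    rw [show 4 * (1 / 4 + 1 / 2 * t) = 1 + 2 * t by ring] at h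
    refine h.congr' ?_
    filter_upwards [hκ] with m hm
    have := (tailComplement_sq_bounds hm).1
    rw [show 4 * tailComplement m (κ m) ^ 2 = (2 * tailComplement m (κ m)) ^ 2 by ring,
      Real.sqrt_sq (by linarith)]
  have hz : Tendsto (fun m => 2 * survival m (κ m) * tailComplement m (κ m)) atTop (𝓝 1) := by
    have hup : Tendsto (fun m : ℕ => (1 - 1 / (m : ℝ))⁻¹) atTop (𝓝 1) := by
      have := (hinv.const_sub 1).inv₀ (by norm_num)
      simpa using this
    refine tendsto_of_tendsto_of_tendsto_of_le_of_le' tendsto_const_nhds hup ?_ ?_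
    · filter_upwards [hκ] with m hm
      exact (survival_bounds hm).1
    · filter_upwards [hκ, eventually_ge_atTop 2] with m hm h2
      obtain ⟨h₁, h₃⟩ := survival_bounds hm
      have hm2 : (2 : ℝ) ≤ m := by exact_mod_cast h2
      have hkm : (κ m : ℝ) ≤ m := by exact_mod_cast hm.le
      have h : 16 * (κ m : ℝ) * (1 / (4 * m)) ^ 2 ≤ 1 / m := by
        have : 16 * (κ m : ℝ) * (1 / (4 * m)) ^ 2 ≤ 16 * m * (1 / (4 * m)) ^ 2 := by gcongr
        refine this.trans (le_of_eq ?_)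
        field_simp
        norm_num
      have hpos : 0 < 1 - 1 / (m : ℝ) := by
        rw [sub_pos, div_lt_one (by linarith)]
        linarith
      rw [← one_div, le_div_iff₀ hpos]
      nlinarith
  have h := hz.div hu (by positivity)
  refine h.congr' ?_
  filter_upwards [hκ] with m hm
  have := (tailComplement_sq_bounds hm).1
  have hne : tailComplement m (κ m) ≠ 0 := by linarith
  simp only [Pi.div_apply]
  field_simp

/-! ### The limit law -/

/-- The survival function `t ↦ Pr (T ≥ t)` of the limit law. -/
noncomputable def limitSurvival (t : ℝ) : ℝ :=
  if t < 0 then 1 else if t ≤ 1 then 1 / √(1 + 2 * t) else 0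

/-- The tail at `0` already has mass `1`, so it stays `1` to the left. The tail at `1` is at least
the atom and at most the left limit `1/√3`; being equal to the atom, it leaves no mass beyond `1`.
-/
theorem measureReal_Ici_eq_limitSurvival (ρ : Measure ℝ) [IsProbabilityMeasure ρ]
    (h : ∀ t : ℝ, 0 ≤ t → t < 1 → ρ.real (Ici t) = 1 / √(1 + 2 * t))
    (h₁ : ρ.real {1} = 1 / √3) (t : ℝ) : ρ.real (Ici t) = limitSurvival t := by
  have hone : ρ.real (Ici 1) = 1 / √3 := by
    refine le_antisymm ?_ (h₁ ▸ measureReal_mono (by simp))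
    have hc : ContinuousAt (fun t : ℝ => 1 / √(1 + 2 * t)) 1 := by
      refine ContinuousAt.div continuousAt_const (by fun_prop) ?_
      positivity
    have hl : Tendsto (fun t : ℝ => 1 / √(1 + 2 * t)) (𝓝[<] 1) (𝓝 (1 / √3)) := by
      have := hc.tendsto.mono_left (nhdsWithin_le_nhds (s := Iio (1 : ℝ)))
      rwa [show (1 : ℝ) + 2 * 1 = 3 by norm_num] at this
    refine ge_of_tendsto hl ?_
    filter_upwards [Ioo_mem_nhdsLT (show (0 : ℝ) < 1 by norm_num)] with t ht
    rw [← h t ht.1.le ht.2]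
    exact measureReal_mono (Ici_subset_Ici.2 ht.2.le)
  rw [limitSurvival]
  split_ifs with h0 h1
  · refine le_antisymm measureReal_le_one ?_
    have := h 0 le_rfl zero_lt_one
    simp only [mul_zero, add_zero, Real.sqrt_one, div_one] at this
    rw [← this]
    exact measureReal_mono (Ici_subset_Ici.2 h0.le)
  · rcases h1.lt_or_eq with h1 | rfl
    · exact h t (not_lt.1 h0) h1
    · rw [hone]
      norm_num
  · refine le_antisymm ?_ measureReal_nonneg
    have hd : ρ.real ({1} ∪ Ici t) = ρ.real {1} + ρ.real (Ici t) :=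
      measureReal_union (by simpa using h1) measurableSet_Ici
    have hle : ρ.real ({1} ∪ Ici t) ≤ ρ.real (Ici 1) := by
      refine measureReal_mono ?_
      rintro x (rfl | hx)
      · exact self_mem_Ici
      · exact (not_le.1 h1).le.trans hx
    linarith

theorem integral_density {t : ℝ} (h₀ : 0 ≤ t) (h₁ : t ≤ 1) :
    ∫ x in t..1, (1 + 2 * x) ^ (-(3 / 2) : ℝ) = 1 / √(1 + 2 * t) - 1 / √3 := by
  have hd : ∀ x ∈ uIcc t 1, HasDerivAt (fun x : ℝ => -(1 + 2 * x) ^ (-(1 / 2) : ℝ))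
      ((1 + 2 * x) ^ (-(3 / 2) : ℝ)) x := fun x hx => by
    rw [uIcc_of_le h₁] at hx
    have hpos : 0 < 1 + 2 * x := by linarith [hx.1]
    have h := (((hasDerivAt_id x).const_mul 2).const_add 1).rpow_const (p := -(1 / 2))
      (Or.inl hpos.ne')
    refine h.neg.congr_deriv ?_
    simp only [id]
    rw [show (-(1 / 2) - 1 : ℝ) = -(3 / 2) by norm_num]
    ring
  have hi : IntervalIntegrable (fun x : ℝ => (1 + 2 * x) ^ (-(3 / 2) : ℝ)) volume t 1 := by
    refine ContinuousOn.intervalIntegrable fun x hx => ?_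
    rw [uIcc_of_le h₁] at hx
    have hpos : 0 < 1 + 2 * x := by linarith [hx.1]
    exact ((by fun_prop : ContinuousAt (fun x : ℝ => 1 + 2 * x) x).rpow_const
      (Or.inl hpos.ne')).continuousWithinAt
  rw [intervalIntegral.integral_eq_sub_of_hasDerivAt hd hi]
  have hs : ∀ y : ℝ, 0 ≤ y → y ^ (-(1 / 2) : ℝ) = 1 / √y := fun y hy => by
    rw [Real.rpow_neg hy, ← Real.sqrt_eq_rpow, one_div]
  rw [hs _ (by norm_num), hs _ (by linarith)]
  norm_num
  ring

theorem withDensity_Ici {t : ℝ} (h₀ : 0 ≤ t) (h₁ : t ≤ 1) :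
    (volume.restrict (Ico (0 : ℝ) 1)).withDensity
      (fun x => ENNReal.ofReal ((1 + 2 * x) ^ (-(3 / 2) : ℝ))) (Ici t) =
      ENNReal.ofReal (1 / √(1 + 2 * t) - 1 / √3) := by
  have hset : Ici t ∩ Ico 0 1 = Ico t 1 := by
    ext x
    simp only [mem_inter_iff, mem_Ici, mem_Ico]
    exact ⟨fun h => ⟨h.1, h.2.2⟩, fun h => ⟨h.1, h₀.trans h.1, h.2⟩⟩
  rw [withDensity_apply _ measurableSet_Ici, Measure.restrict_restrict measurableSet_Ici, hset,
    ← integral_density h₀ h₁, intervalIntegral.integral_of_le h₁, ← integral_Ico_eq_integral_Ioc]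
  rw [← ofReal_integral_eq_lintegral_ofReal]
  · have hi : ContinuousOn (fun x : ℝ => (1 + 2 * x) ^ (-(3 / 2) : ℝ)) (Icc t 1) := fun x hx => by
      have hpos : 0 < 1 + 2 * x := by linarith [hx.1]
      exact ((by fun_prop : ContinuousAt (fun x : ℝ => 1 + 2 * x) x).rpow_const
        (Or.inl hpos.ne')).continuousWithinAt
    exact hi.integrableOn_Icc.mono_set Ico_subset_Icc_self
  · refine (ae_restrict_iff' measurableSet_Ico).2 (Eventually.of_forall fun x hx => ?_)
    have hpos : 0 < 1 + 2 * x := by linarith [hx.1]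
    exact Real.rpow_nonneg hpos.le _

theorem limitLaw_Ici {t : ℝ} (h₀ : 0 ≤ t) (h₁ : t ≤ 1) :
    limitLaw (Ici t) = ENNReal.ofReal (1 / √(1 + 2 * t)) := by
  have h : 1 / √3 ≤ 1 / √(1 + 2 * t) := by
    apply one_div_le_one_div_of_le
    · positivity
    · exact Real.sqrt_le_sqrt (by linarith)
  rw [limitLaw, Measure.add_apply, withDensity_Ici h₀ h₁, Measure.smul_apply,
    Measure.dirac_apply' _ measurableSet_Ici, indicator_of_mem (by exact h₁), Pi.one_apply,
    smul_eq_mul, mul_one, ← ENNReal.ofReal_add (by linarith) (by positivity)]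
  congr 1
  ring

theorem limitLaw_Iio_zero : limitLaw (Iio 0) = 0 := by
  rw [limitLaw, Measure.add_apply, Measure.smul_apply, Measure.dirac_apply' _ measurableSet_Iio,
    indicator_of_notMem (by simp), smul_zero, add_zero]
  refine withDensity_absolutelyContinuous _ _ ?_
  rw [Measure.restrict_apply measurableSet_Iio]
  convert measure_empty (μ := volume)
  ext x
  simp only [mem_inter_iff, mem_Iio, mem_Ico, mem_empty_iff_false, iff_false]
  intro h
  linarith [h.1, h.2.1]

theorem limitLaw_singleton_one : limitLaw {1} = ENNReal.ofReal (1 / √3) := by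
  have h : (volume.restrict (Ico (0 : ℝ) 1)).withDensity
      (fun x => ENNReal.ofReal ((1 + 2 * x) ^ (-(3 / 2) : ℝ))) {1} = 0 :=
    withDensity_absolutelyContinuous _ _ (measure_singleton 1)
  rw [limitLaw, Measure.add_apply, h, Measure.smul_apply,
    Measure.dirac_apply' _ (measurableSet_singleton 1), indicator_of_mem (by simp)]
  simp

instance isProbabilityMeasure_limitLaw : IsProbabilityMeasure limitLaw where
  measure_univ := by
    rw [← Iio_union_Ici (a := (0 : ℝ)), measure_union (Iio_disjoint_Ici le_rfl) measurableSet_Ici,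
      limitLaw_Iio_zero, limitLaw_Ici le_rfl zero_le_one]
    simp

theorem limitLaw_real_Ici {t : ℝ} (h₀ : 0 ≤ t) (h₁ : t < 1) :
    limitLaw.real (Ici t) = 1 / √(1 + 2 * t) := by
  rw [measureReal_def, limitLaw_Ici h₀ h₁.le, ENNReal.toReal_ofReal (by positivity)]

theorem limitLaw_real_singleton_one : limitLaw.real {1} = 1 / √3 := by
  rw [measureReal_def, limitLaw_singleton_one, ENNReal.toReal_ofReal (by positivity)]

theorem limitLaw_real_Ici_eq_limitSurvival (t : ℝ) : limitLaw.real (Ici t) = limitSurvival t :=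
  measureReal_Ici_eq_limitSurvival _ (fun _ => limitLaw_real_Ici) limitLaw_real_singleton_one t

theorem eq_limitLaw_iff (ρ : Measure ℝ) [IsProbabilityMeasure ρ] :
    ρ = limitLaw ↔ (∀ t : ℝ, 0 ≤ t → t < 1 → ρ.real (Ici t) = 1 / √(1 + 2 * t)) ∧
      ρ.real {1} = 1 / √3 := by
  constructor
  · rintro rfl
    exact ⟨fun _ => limitLaw_real_Ici, limitLaw_real_singleton_one⟩
  · rintro ⟨h, h₁⟩
    refine Measure.ext_of_Ici _ _ fun t => ?_
    rw [← measureReal_eq_measureReal_iff, measureReal_Ici_eq_limitSurvival ρ h h₁,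
      limitLaw_real_Ici_eq_limitSurvival]

/-! ### Weak convergence and the random variables -/

/-- Convergence of the survival functions at every point implies weak convergence. -/
theorem tendsto_of_tendsto_measureReal_Ici {μ : ℕ → ProbabilityMeasure ℝ} {ν : ProbabilityMeasure ℝ}
    (h : ∀ t : ℝ, Tendsto (fun n => (μ n : Measure ℝ).real (Ici t)) atTop
      (𝓝 ((ν : Measure ℝ).real (Ici t)))) : Tendsto μ atTop (𝓝 ν) := by
  have hIco (ρ : ProbabilityMeasure ℝ) {a b : ℝ} (hab : a ≤ b) :
      (ρ : Measure ℝ).real (Ico a b) =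
        (ρ : Measure ℝ).real (Ici a) - (ρ : Measure ℝ).real (Ici b) := by
    rw [← measureReal_sdiff (Ici_subset_Ici.2 hab) measurableSet_Ici, Ici_sdiff_Ici]
  -- Half-open intervals form a π-system containing arbitrarily small neighbourhoods of each point,
  -- and their masses are differences of tails. Tails converge even at atoms of the limit, so no
  -- restriction to continuity points is needed.
  refine IsPiSystem.tendsto_probabilityMeasure_of_tendsto_of_mem
    (S := {s | ∃ a b : ℝ, s = Ico a b}) ?_ ?_ ?_ ?_
  · rintro _ ⟨a, b, rfl⟩ _ ⟨c, d, rfl⟩ _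
    exact ⟨_, _, Ico_inter_Ico⟩
  · rintro _ ⟨a, b, rfl⟩
    exact measurableSet_Ico
  · intro u hu x hx
    obtain ⟨a, b, hab, hsub⟩ := (mem_nhds_iff_exists_Ioo_subset).1 (hu.mem_nhds hx)
    obtain ⟨c, hc⟩ := exists_between hab.1
    exact ⟨Ico c b, ⟨c, b, rfl⟩, Ico_mem_nhds hc.2 hab.2,
      fun y hy => hsub ⟨hc.1.trans_le hy.1, hy.2⟩⟩
  · rintro _ ⟨a, b, rfl⟩
    rw [← NNReal.tendsto_coe]
    change Tendsto (fun n => (μ n : Measure ℝ).real (Ico a b)) atTop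
      (𝓝 ((ν : Measure ℝ).real (Ico a b)))
    rcases le_total a b with hab | hab
    · simp only [hIco _ hab]
      exact (h a).sub (h b)
    · simp [Ico_eq_empty_of_le hab]

theorem measureReal_mem_eq_sum_limitProportion {Ω : Type*} [MeasurableSpace Ω] {P : Measure Ω}
    [IsProbabilityMeasure P] {K : Ω → ℕ} (hK : Measurable K) {m : ℕ} (hm : 1 ≤ m)
    (hP : ∀ k : Fin m, P.real {ω | K ω = (k : ℕ)} = limitProportion m k)
    (S : Set ℕ) [DecidablePred (· ∈ S)] :
    P.real {ω | K ω ∈ S} =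
      ∑ j ∈ Finset.univ.filter (fun j : Fin m => (j : ℕ) ∈ S), limitProportion m j := by
  have hmeas (k : ℕ) : MeasurableSet {ω | K ω = k} := hK (measurableSet_singleton k)
  have hU (s : Finset (Fin m)) : P.real (⋃ j ∈ s, {ω | K ω = (j : ℕ)}) =
      ∑ j ∈ s, limitProportion m j := by
    rw [measureReal_biUnion_finset]
    · exact Finset.sum_congr rfl fun j _ => hP j
    · intro i _ j _ hij
      refine Set.disjoint_left.2 fun ω (hi : K ω = i) (hj : K ω = j) => hij ?_
      exact Fin.ext (hi.symm.trans hj)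
    · exact fun j _ => hmeas j
  -- Only the masses of the points `k < m` are prescribed; they sum to `1`, which excludes larger
  -- values almost surely.
  have hlt : ∀ᵐ ω ∂P, K ω < m := by
    have h : P (⋃ j ∈ (Finset.univ : Finset (Fin m)), {ω | K ω = (j : ℕ)}) = 1 := by
      have := hU Finset.univ
      rw [sum_limitProportion hm, measureReal_def] at this
      exact (ENNReal.toReal_eq_one_iff _).1 this
    have hm' : MeasurableSet (⋃ j ∈ (Finset.univ : Finset (Fin m)), {ω | K ω = (j : ℕ)}) :=
      Finset.measurableSet_biUnion _ fun j _ => hmeas j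
    have h' := (prob_compl_eq_zero_iff hm').2 h
    filter_upwards [compl_mem_ae_iff.2 h'] with ω hω
    simp only [compl_compl, mem_iUnion] at hω
    obtain ⟨j, -, hj⟩ := hω
    have hj : K ω = j := hj
    rw [hj]
    exact j.2
  rw [← hU]
  refine measureReal_congr ?_
  filter_upwards [hlt] with ω hω
  refine propext ⟨fun h => ?_, fun h => ?_⟩
  · exact mem_biUnion (x := (⟨K ω, hω⟩ : Fin m))
      (Finset.mem_filter.2 ⟨Finset.mem_univ _, h⟩) rfl
  · obtain ⟨j, hj, hKj⟩ := mem_iUnion₂.1 h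
    have hKj : K ω = j := hKj
    change K ω ∈ S
    rw [hKj]
    exact (Finset.mem_filter.1 hj).2

theorem ceil_le_iff_le_div {t : ℝ} {m : ℕ} (hm : 2 ≤ m) (k : ℕ) :
    ⌈t * ((m : ℝ) - 1)⌉ ≤ (k : ℤ) ↔ t ≤ (k : ℝ) / ((m : ℝ) - 1) := by
  have h : (0 : ℝ) < (m : ℝ) - 1 := by
    have : (2 : ℝ) ≤ m := by exact_mod_cast hm
    linarith
  rw [Int.ceil_le, le_div_iff₀ h, Int.cast_natCast]

theorem natCeil_mul_lt {t : ℝ} (h₁ : t ≤ 1) {m : ℕ} (hm : 1 ≤ m) :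
    ⌈t * ((m : ℝ) - 1)⌉₊ < m := by
  have hm' : (1 : ℝ) ≤ m := by exact_mod_cast hm
  have : ⌈t * ((m : ℝ) - 1)⌉₊ ≤ m - 1 := by
    rw [Nat.ceil_le, Nat.cast_sub hm, Nat.cast_one]
    exact mul_le_of_le_one_left (by linarith) h₁
  omega

theorem tendsto_natCeil_mul_div {t : ℝ} (h₀ : 0 ≤ t) :
    Tendsto (fun m : ℕ => (⌈t * ((m : ℝ) - 1)⌉₊ : ℝ) / m) atTop (𝓝 t) := by
  have hinv : Tendsto (fun m : ℕ => 1 / (m : ℝ)) atTop (𝓝 0) := tendsto_one_div_atTop_nhds_zero_nat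
  have hlow : Tendsto (fun m : ℕ => t - t * (1 / (m : ℝ))) atTop (𝓝 t) := by
    simpa using (hinv.const_mul t).const_sub t
  have hup := hlow.add hinv
  rw [add_zero] at hup
  refine tendsto_of_tendsto_of_tendsto_of_le_of_le' hlow hup ?_ ?_
  · filter_upwards [eventually_ge_atTop 1] with m hm
    have hm' : (1 : ℝ) ≤ m := by exact_mod_cast hm
    rw [le_div_iff₀ (by linarith)]
    refine le_trans (le_of_eq ?_) (Nat.le_ceil _)
    field_simp
  · filter_upwards [eventually_ge_atTop 1] with m hm
    have hm' : (1 : ℝ) ≤ m := by exact_mod_cast hm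
    rw [div_le_iff₀ (by linarith)]
    refine (Nat.ceil_lt_add_one (mul_nonneg h₀ (by linarith))).le.trans (le_of_eq ?_)
    field_simp

theorem tendsto_sum_limitProportion {t : ℝ} (h₀ : 0 ≤ t) (h₁ : t ≤ 1) :
    Tendsto (fun m : ℕ => ∑ j ∈ Finset.univ.filter
      (fun j : Fin m => ⌈t * ((m : ℝ) - 1)⌉ ≤ ((j : ℕ) : ℤ)), limitProportion m j) atTop
      (𝓝 (1 / √(1 + 2 * t))) := by
  have hlt : ∀ᶠ m : ℕ in atTop, ⌈t * ((m : ℝ) - 1)⌉₊ < m := by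
    filter_upwards [eventually_ge_atTop 1] with m hm
    exact natCeil_mul_lt h₁ hm
  refine (tendsto_survival h₀ hlt (tendsto_natCeil_mul_div h₀)).congr' ?_
  filter_upwards [hlt] with m hm
  rw [← sum_limitProportion_eq_survival hm]
  refine Finset.sum_congr (Finset.filter_congr fun j _ => ?_) fun _ _ => rfl
  rw [Nat.ceil_le, Int.ceil_le, Int.cast_natCast]

theorem theorem7 :
    -- for every `m ≥ 2` the limiting proportions exist and form a probability distribution
    (∀ m : ℕ, 2 ≤ m →
      (∀ k : Fin m, Tendsto (fun n : ℕ => levelProportion m n k) atTop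
        (𝓝 (limitProportion m k))) ∧
      (∀ k : Fin m, 0 ≤ limitProportion m k) ∧
      ∑ k : Fin m, limitProportion m k = 1) ∧
    -- the limit law is a probability measure, determined by its survival function and its atom
    ∃ μ : ProbabilityMeasure ℝ, (μ : Measure ℝ) = limitLaw ∧
      (∀ ρ : ProbabilityMeasure ℝ, ρ = μ ↔
        (∀ t : ℝ, 0 ≤ t → t < 1 → (ρ : Measure ℝ).real (Ici t) = 1 / √(1 + 2 * t)) ∧
        (ρ : Measure ℝ).real {1} = 1 / √3) ∧
      -- for all random variables `K m` with `Pr (K m = k) = p_k(m)` and `T m = K m / (m - 1)`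
      ∀ (Ω : ℕ → Type*) [∀ m, MeasurableSpace (Ω m)] (P : ∀ m, Measure (Ω m))
        [∀ m, IsProbabilityMeasure (P m)] (K : ∀ m, Ω m → ℕ) (T : ∀ m, Ω m → ℝ),
        (∀ m, Measurable (K m)) →
        (∀ m, 2 ≤ m → ∀ k : Fin m, (P m).real {ω | K m ω = (k : ℕ)} = limitProportion m k) →
        (∀ m ω, T m ω = (K m ω : ℝ) / ((m : ℝ) - 1)) →
        (∀ t : ℝ, 0 ≤ t → t < 1 →
          (∀ m, 2 ≤ m → (P m).real {ω | t ≤ T m ω} =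
            ∑ j ∈ Finset.univ.filter
              (fun j : Fin m => ⌈t * ((m : ℝ) - 1)⌉ ≤ ((j : ℕ) : ℤ)), limitProportion m j) ∧
          Tendsto (fun m => (P m).real {ω | t ≤ T m ω}) atTop (𝓝 (1 / √(1 + 2 * t)))) ∧
        (∀ m (hm : 2 ≤ m), (P m).real {ω | T m ω = 1} =
          limitProportion m ⟨m - 1, by omega⟩) ∧
        Tendsto (fun m => (P m).real {ω | T m ω = 1}) atTop (𝓝 (1 / √3)) ∧
        TendstoInDistribution T atTop (id : ℝ → ℝ) P (μ : Measure ℝ) := by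
  obtain ⟨μ, hμ⟩ : ∃ μ : ProbabilityMeasure ℝ, (μ : Measure ℝ) = limitLaw :=
    ⟨⟨limitLaw, isProbabilityMeasure_limitLaw⟩, rfl⟩
  refine ⟨fun m hm => ⟨tendsto_levelProportion m, limitProportion_nonneg m,
    sum_limitProportion (by omega)⟩, μ, hμ, fun ρ => ?_, ?_⟩
  · refine Iff.trans ?_ (eq_limitLaw_iff (ρ : Measure ℝ))
    exact ⟨fun h => h ▸ hμ, fun h => Subtype.ext (h.trans hμ.symm)⟩
  intro Ω _ P _ K T hK hP hT
  have htail (t : ℝ) (m : ℕ) (hm : 2 ≤ m) : (P m).real {ω | t ≤ T m ω} =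
      ∑ j ∈ Finset.univ.filter
        (fun j : Fin m => ⌈t * ((m : ℝ) - 1)⌉ ≤ ((j : ℕ) : ℤ)), limitProportion m j := by
    have h := measureReal_mem_eq_sum_limitProportion (hK m) (by omega) (hP m hm)
      {k : ℕ | ⌈t * ((m : ℝ) - 1)⌉ ≤ (k : ℤ)}
    refine Eq.trans ?_ h
    congr 1
    ext ω
    change t ≤ T m ω ↔ ⌈t * ((m : ℝ) - 1)⌉ ≤ (K m ω : ℤ)
    rw [hT, ceil_le_iff_le_div hm]
  have hlim (t : ℝ) (h₀ : 0 ≤ t) (h₁ : t ≤ 1) :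
      Tendsto (fun m => (P m).real {ω | t ≤ T m ω}) atTop (𝓝 (1 / √(1 + 2 * t))) := by
    refine (tendsto_sum_limitProportion h₀ h₁).congr' ?_
    filter_upwards [eventually_ge_atTop 2] with m hm
    exact (htail t m hm).symm
  have htop (m : ℕ) (hm : 2 ≤ m) : (P m).real {ω | T m ω = 1} =
      limitProportion m ⟨m - 1, by omega⟩ := by
    rw [← hP m hm]
    congr 1
    ext ω
    have hm' : (2 : ℝ) ≤ m := by exact_mod_cast hm
    change T m ω = 1 ↔ K m ω = m - 1
    rw [hT, div_eq_one_iff_eq (by linarith), ← Nat.cast_inj (R := ℝ),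
      Nat.cast_sub (by omega : 1 ≤ m), Nat.cast_one]
  -- At `t = 1` the tail sum reduces to the top index, so the limit of the atoms is the case `t = 1`
  -- of the tail limit.
  have hone (m : ℕ) (hm : 2 ≤ m) :
      (P m).real {ω | 1 ≤ T m ω} = limitProportion m ⟨m - 1, by omega⟩ := by
    rw [htail 1 m hm]
    refine (Finset.sum_congr ?_ fun _ _ => rfl).trans
      (Finset.sum_singleton (limitProportion m) ⟨m - 1, by omega⟩)
    ext j
    have hj := j.2
    rw [Finset.mem_filter, Finset.mem_singleton, one_mul, Int.ceil_le, Fin.ext_iff,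
      Int.cast_natCast, sub_le_iff_le_add]
    have e : (m : ℝ) ≤ (j : ℕ) + 1 ↔ m ≤ j + 1 := by exact_mod_cast Iff.rfl
    rw [e]
    simp only [Finset.mem_univ, true_and]
    omega
  have hpos (m : ℕ) (hm : 2 ≤ m) (ω : Ω m) : 0 ≤ T m ω := by
    have hm' : (2 : ℝ) ≤ m := by exact_mod_cast hm
    rw [hT]
    exact div_nonneg (Nat.cast_nonneg _) (by linarith)
  have hTm (m : ℕ) : Measurable (T m) := by
    rw [funext (hT m)]
    exact (measurable_from_nat.comp (hK m)).div_const _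
  refine ⟨fun t h₀ h₁ => ⟨htail t, hlim t h₀ h₁.le⟩, htop, ?_, ?_⟩
  · have h := hlim 1 zero_le_one le_rfl
    rw [show (1 : ℝ) + 2 * 1 = 3 by norm_num] at h
    refine h.congr' ?_
    filter_upwards [eventually_ge_atTop 2] with m hm
    rw [hone m hm, htop m hm]
  · refine ⟨fun m => (hTm m).aemeasurable, aemeasurable_id, ?_⟩
    refine tendsto_of_tendsto_measureReal_Ici fun t => ?_
    simp only [ProbabilityMeasure.coe_mk, Measure.map_id,
      map_measureReal_apply (hTm _) measurableSet_Ici]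
    rw [hμ, limitLaw_real_Ici_eq_limitSurvival]
    change Tendsto (fun m => (P m).real {ω | t ≤ T m ω}) atTop _
    rw [limitSurvival]
    split_ifs with h0 h1
    · refine tendsto_const_nhds.congr' ?_
      filter_upwards [eventually_ge_atTop 2] with m hm
      have : {ω | t ≤ T m ω} = univ := eq_univ_of_forall fun ω => h0.le.trans (hpos m hm ω)
      rw [this, probReal_univ]
    · exact hlim t (not_lt.1 h0) h1
    · refine tendsto_const_nhds.congr' ?_
      filter_upwards [eventually_ge_atTop 2] with m hm
      rw [htail t m hm, Finset.filter_false_of_mem, Finset.sum_empty]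
      intro j _ hj
      have hm' : (2 : ℝ) ≤ m := by exact_mod_cast hm
      rw [ceil_le_iff_le_div hm, le_div_iff₀ (by linarith)] at hj
      have hj' : ((j : ℕ) : ℝ) ≤ m - 1 := by
        rw [le_sub_iff_add_le]
        exact_mod_cast j.2
      nlinarith [not_le.1 h1]
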